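/- Let $C=[m]$ be a finite set of experts. A task $d$ has a latent profile $(u(d,c))_{c\in C}\in\{0,1\}^C$, where $u(d,c)=1$ means that expert $c$ solves $d$. Let $S\subseteq C$ be a committee and $A\subseteq C\setminus S$ a nonempty set of candidates. For a law $D$ of tasks with miss rate $\rho(S)=\Pr_{d\sim D}[u(d,c)=0\ \forall c\in S]>0$, the conditional failure law is the law of $d\sim D$ given that no member of $S$ solves $d$. Let $q(a\mid S)$ (the rescue rate) be the probability of $u(d,a)=1$ under this law, $q^*=\max_{a\in A}q(a\mid S)$ and $\Delta_q(a)=q^*-q(a\mid S)$. A (possibly randomized) algorithm has access to an infinite i.i.d. sequence of tasks from the conditional failure law, which it sees only through an oracle: it adaptively queries pairs $(d,c)$ of a sampled task and an expert $c\in C$, receives $u(d,c)$, and may stop at any time and return an expert. $Q_{\mathrm{cand}}$ denotes the number of its queries, repetitions included, whose expert lies in $A$. **Theorem 4.6.** There is a universal constant $\kappa>0$ such that the following holds for all $\eta\in(0,1)$, $\delta\in(0,1/4]$, and all $C,S,A$ as above. For every $c^*\in A$ and all prescribed gaps $\gamma_a\in(0,1/4]$, $a\in A\setminus\{c^*\}$,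 there is a law $D$ of tasks with $\rho(S)>0$, $\Delta_q(c^*)=0$ and $\Delta_q(a)=\gamma_a$ for all $a\in A\setminus\{c^*\}$, such that every algorithm that, under every conditional failure law, with probability at least $1-\delta$ stops and returns some $\widehat c\in A$ with $q(\widehat c\mid S)\ge q^*-\eta$, satisfies under the conditional failure law of $D$ $$\mathbb E[Q_{\mathrm{cand}}]\ \ge\ \kappa\sum_{a\in A:\ \Delta_q(a)>\eta}\frac{\log(1/\delta)}{\Delta_q(a)^2}.$$ -/

import Mathlib

open MeasureTheory ProbabilityTheory
open scoped ENNReal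

namespace Rescue

/-- The latent binary feedback profile of a task: `p c = true` means that expert `c`
solves the task, i.e. `u(d, c) = 1`. Experts are `Fin m`. -/
abbrev Profile (m : ℕ) : Type := Fin m → Bool

/-- The event `U(d, S) = 0`: no member of the committee `S` solves the task. -/
def missed {m : ℕ} (S : Finset (Fin m)) : Set (Profile m) :=
  {p | ¬ ∃ c ∈ S, p c = true}

/-- The miss rate `ρ(S) = Pr[U(d, S) = 0]`, where `D` is the law of the profile of a task. -/
noncomputable def missRate {m : ℕ} (D : Measure (Profile m)) (S : Finset (Fin m)) : ℝ :=
  D.real (missed S)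

/-- The conditional failure law: the law of the profile of `d` given `U(d, S) = 0`. -/
noncomputable def failureLaw {m : ℕ} (D : Measure (Profile m)) (S : Finset (Fin m)) :
    Measure (Profile m) :=
  ProbabilityTheory.cond D (missed S)

/-- The rescue rate `q(c ∣ S) = Pr[u(d, c) = 1 ∣ U(d, S) = 0]`. -/
noncomputable def rescueRate {m : ℕ} (D : Measure (Profile m)) (S : Finset (Fin m))
    (c : Fin m) : ℝ :=
  (failureLaw D S).real {p | p c = true}

/-- The best rescue rate `q* = max_{a ∈ A} q(a ∣ S)`. -/
noncomputable def bestRate {m : ℕ} (D : Measure (Profile m)) (S A : Finset (Fin m))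
    (hA : A.Nonempty) : ℝ :=
  A.sup' hA (rescueRate D S)

/-- The rescue-rate gap `Δ_q(a) = q* - q(a ∣ S)`. -/
noncomputable def gap {m : ℕ} (D : Measure (Profile m)) (S A : Finset (Fin m))
    (hA : A.Nonempty) (a : Fin m) : ℝ :=
  bestRate D S A hA - rescueRate D S a

/-- One move of an algorithm: call the oracle on a pair (sampled task, expert), where the sampled
tasks are accessible only through their handles `0, 1, 2, …`, or stop and return an expert. -/
inductive Move (m : ℕ) : Type
  | query (task : ℕ) (expert : Fin m) : Move m
  | output (expert : Fin m) : Move m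

/-- A randomized adaptive selection algorithm. Its internal randomness is a seed drawn from an
arbitrary probability space; the next move is an arbitrary function of the seed and of the
oracle answers received so far (latest answer first). The past queries are themselves
functions of the seed and the past answers, so they need not be recorded. There is no bound on
the number of sampled tasks or on the number of queries, and the algorithm need not halt. -/
structure Algorithm (m : ℕ) (R : Type*) [MeasurableSpace R] where
  seedLaw : Measure R
  isProbabilityMeasure_seedLaw : IsProbabilityMeasure seedLaw
  move : R → List Bool → Move m
  measurableSet_move : ∀ (answers : List Bool) (x : Move m),
    MeasurableSet {r | move r answers = x}

namespace Algorithm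

variable {m : ℕ} {R : Type*} [MeasurableSpace R]

/-- The oracle answers received during the first `t` moves, on the seed `r` and the sampled tasks
with profiles `ω 0, ω 1, …`. The list no longer changes once the algorithm has stopped. -/
def answers (alg : Algorithm m R) (r : R) (ω : ℕ → Profile m) : ℕ → List Bool
  | 0 => []
  | t + 1 =>
    match alg.move r (alg.answers r ω t) with
    | Move.query i c => ω i c :: alg.answers r ω t
    | Move.output _ => alg.answers r ω t

/-- The move made at time `t`; once the algorithm has stopped, its last move is repeated. -/
def moveAt (alg : Algorithm m R) (r : R) (ω : ℕ → Profile m) (t : ℕ) : Move m :=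
  alg.move r (alg.answers r ω t)

/-- The algorithm stops and returns `c`. -/
def Returns (alg : Algorithm m R) (r : R) (ω : ℕ → Profile m) (c : Fin m) : Prop :=
  ∃ t, alg.moveAt r ω t = Move.output c

open Classical in
/-- The number `Q_cand` of oracle calls (with repetitions, possibly infinite) whose expert belongs
to the candidate set `A`. -/
noncomputable def candQueries (alg : Algorithm m R) (A : Finset (Fin m)) (r : R)
    (ω : ℕ → Profile m) : ℝ≥0∞ :=
  ∑' t : ℕ, if ∃ i, ∃ c ∈ A, alg.moveAt r ω t = Move.query i c then 1 else 0

/-- The joint law of the seed and of the sampled tasks: the tasks are i.i.d. from the conditional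
failure law of `S`, independently of the seed. -/
noncomputable def runLaw (alg : Algorithm m R) (D : Measure (Profile m)) (S : Finset (Fin m)) :
    Measure (R × (ℕ → Profile m)) :=
  alg.seedLaw.prod (Measure.infinitePi fun _ : ℕ => failureLaw D S)

/-- Under every conditional failure law of `S`, the algorithm stops and returns some `c ∈ A` with
`q(c ∣ S) ≥ q* - η` with probability at least `1 - δ`. -/
def IsReliable (alg : Algorithm m R) (S A : Finset (Fin m)) (hA : A.Nonempty) (η δ : ℝ) : Prop :=
  ∀ D : Measure (Profile m), IsProbabilityMeasure D → 0 < missRate D S →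
    ENNReal.ofReal (1 - δ) ≤
      alg.runLaw D S {x | ∃ c ∈ A, alg.Returns x.1 x.2 c ∧
        bestRate D S A hA - η ≤ rescueRate D S c}

/-- The expected number of candidate queries on the instance `D`. -/
noncomputable def expectedCandQueries (alg : Algorithm m R) (D : Measure (Profile m))
    (S A : Finset (Fin m)) : ℝ≥0∞ :=
  ∫⁻ x, alg.candQueries A x.1 x.2 ∂(alg.runLaw D S)

end Algorithm

end Rescue

/-!
The hard law makes all experts independent: the candidate `cstar` succeeds with probability `1/2`,
every other candidate `a` with probability `1/2 - γ a`, and nobody outside `A` ever succeeds, so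
that conditioning on the failure of the committee is vacuous. Fix a candidate `a` with `γ a > η`.
Raising its success probability to `1/2 + γ a` makes it the only acceptable answer, so a reliable
algorithm returns `a` with probability at most `δ` under the hard law and at least `1 - δ` under
the alternative. Telling the two laws apart this well takes relative entropy of order
`log (1 / δ)`, and only fresh queries to `a` provide any, at most `64/3 * γ a ^ 2` each. Summing
over `a` gives the bound.

No likelihood ratio on the space of runs is needed. For a fixed seed the list of answers is a Markov
chain (`Algorithm.integral_answers_succ`): a repeated query returns the known answer, while the
entry hit by a fresh query is independent of the history, because the history does not depend on it
(`taskLaw_real_inter_entry`, `Algorithm.answers_setEntry`). Applying the two-point Gibbs inequality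
`∑ p g ≤ χ²(p, q) + log ∑ q exp g` at each step yields, by induction on time, the Gibbs
variational inequality for the whole history (`Algorithm.gibbs_answers`). With the test function
`±log ((1 - δ) / δ)`, the sign telling whether `a` has been returned, and with `log X ≤ X - 1`,
this becomes an inequality that is linear in the probabilities and can be averaged over the seed
(`Algorithm.change_of_law`). Letting time tend to infinity gives the lower bound for the
number of queries to `a` (`Algorithm.le_lintegral_expertQueries`); runs that never halt cause no
trouble.
-/

namespace Rescue

/-! ### Product Bernoulli laws and resampling one coordinate -/

section Resampling

variable {ι : Type*} {X : ι → Type*} [∀ i, MeasurableSpace (X i)]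
  (μ : (i : ι) → Measure (X i)) [∀ i, IsProbabilityMeasure (μ i)]

/-- Replacing one coordinate of a product sample by an independent fresh copy leaves the product
law unchanged. -/
lemma measurePreserving_update_infinitePi [DecidableEq ι] (j : ι) :
    MeasurePreserving (fun z : ((i : ι) → X i) × X j => Function.update z.1 j z.2)
      ((Measure.infinitePi μ).prod (μ j)) (Measure.infinitePi μ) := by
  have hmeas : Measurable (fun z : ((i : ι) → X i) × X j => Function.update z.1 j z.2) :=
    measurable_update'.comp measurable_id
  refine ⟨hmeas, Measure.eq_infinitePi μ fun s t ht => ?_⟩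
  rw [Measure.map_apply hmeas (MeasurableSet.pi s.countable_toSet fun i _ => ht i)]
  by_cases hj : j ∈ s
  · have hpre : (fun z : ((i : ι) → X i) × X j => Function.update z.1 j z.2) ⁻¹' (Set.pi s t)
        = (Set.pi (s.erase j : Finset ι) t) ×ˢ (t j) := by
      ext ⟨x, y⟩
      simp only [Set.mem_preimage, Set.mem_pi, Finset.mem_coe, Set.mem_prod, Finset.mem_erase]
      constructor
      · intro h
        refine ⟨fun i hi => ?_, ?_⟩
        · simpa [Function.update_of_ne hi.1] using h i hi.2
        · simpa using h j hj
      · rintro ⟨h1, h2⟩ i hi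
        by_cases hij : i = j
        · subst hij; simpa using h2
        · simpa [Function.update_of_ne hij] using h1 i ⟨hij, hi⟩
    rw [hpre, Measure.prod_prod, Measure.infinitePi_pi μ (fun i _ => ht i),
      Finset.prod_erase_mul _ _ hj]
  · have hpre : (fun z : ((i : ι) → X i) × X j => Function.update z.1 j z.2) ⁻¹' (Set.pi s t)
        = (Set.pi s t) ×ˢ Set.univ := by
      ext ⟨x, y⟩
      simp only [Set.mem_preimage, Set.mem_pi, Finset.mem_coe, Set.mem_prod, Set.mem_univ,
        and_true]
      refine forall₂_congr fun i hi => ?_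
      rw [Function.update_of_ne (show i ≠ j from fun h => hj (h ▸ hi))]
    rw [hpre, Measure.prod_prod, Measure.infinitePi_pi μ (fun i _ => ht i), measure_univ, mul_one]

/-- An event that does not depend on the coordinate `j` is independent of that coordinate. -/
lemma infinitePi_inter_eval_of_invariant [DecidableEq ι] (j : ι) {E : Set ((i : ι) → X i)}
    (hE : MeasurableSet E) (hinv : ∀ ω x, Function.update ω j x ∈ E ↔ ω ∈ E)
    {V : Set (X j)} (hV : MeasurableSet V) :
    Measure.infinitePi μ (E ∩ {ω | ω j ∈ V}) = Measure.infinitePi μ E * μ j V := by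
  have hV' : MeasurableSet {ω : (i : ι) → X i | ω j ∈ V} := measurable_pi_apply j hV
  rw [← (measurePreserving_update_infinitePi μ j).measure_preimage
      (hE.inter hV').nullMeasurableSet, ← Measure.prod_prod]
  congr 1
  ext ⟨ω, x⟩
  simp [hinv]

end Resampling

variable {m : ℕ}

/-- The law of a profile whose entries are independent, entry `c` being `true` with
probability `θ c`. -/
noncomputable def productLaw (θ : Fin m → unitInterval) : Measure (Profile m) :=
  Measure.infinitePi fun c => bernoulliMeasure true false (θ c)

instance (θ : Fin m → unitInterval) : IsProbabilityMeasure (productLaw θ) := by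
  unfold productLaw; infer_instance

/-- The law of an infinite i.i.d. sequence of tasks with profiles drawn from `productLaw θ`. -/
noncomputable def taskLaw (θ : Fin m → unitInterval) : Measure (ℕ → Profile m) :=
  Measure.infinitePi fun _ => productLaw θ

instance (θ : Fin m → unitInterval) : IsProbabilityMeasure (taskLaw θ) := by
  unfold taskLaw; infer_instance

/-- The task sequence `ω` with the entry of expert `c` on task `i` replaced by `x`. -/
def setEntry (ω : ℕ → Profile m) (i : ℕ) (c : Fin m) (x : Bool) : ℕ → Profile m :=
  Function.update ω i (Function.update (ω i) c x)

lemma setEntry_same (ω : ℕ → Profile m) (i : ℕ) (c : Fin m) (x : Bool) :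
    setEntry ω i c x i c = x := by
  simp [setEntry]

lemma setEntry_of_ne (ω : ℕ → Profile m) {i j : ℕ} {c d : Fin m} (x : Bool)
    (h : ¬(j = i ∧ d = c)) : setEntry ω i c x j d = ω j d := by
  unfold setEntry
  by_cases hj : j = i
  · subst hj
    have hd : d ≠ c := fun hd => h ⟨rfl, hd⟩
    simp [Function.update_of_ne hd]
  · simp [Function.update_of_ne hj]

/-- An event that does not depend on the entry of expert `c` on task `i` is independent of
that entry. -/
lemma taskLaw_real_inter_entry (θ : Fin m → unitInterval) (i : ℕ) (c : Fin m)
    {E : Set (ℕ → Profile m)} (hE : MeasurableSet E)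
    (hinv : ∀ ω x, setEntry ω i c x ∈ E ↔ ω ∈ E) :
    (taskLaw θ).real (E ∩ {ω | ω i c = true}) = (taskLaw θ).real E * θ c := by
  classical
  have hflat : taskLaw θ = (Measure.infinitePi
      fun p : ℕ × Fin m => bernoulliMeasure true false (θ p.2)).map
        (MeasurableEquiv.curry ℕ (Fin m) Bool) :=
    (Measure.infinitePi_map_curry
      (fun (_ : ℕ) (c : Fin m) => bernoulliMeasure true false (θ c))).symm
  have hT : MeasurableSet {ω : ℕ → Profile m | ω i c = true} :=
    (show Measurable fun ω : ℕ → Profile m => ω i c by fun_prop) (measurableSet_singleton true)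
  have hup : ∀ (f : ℕ × Fin m → Bool) (x : Bool),
      MeasurableEquiv.curry ℕ (Fin m) Bool (Function.update f (i, c) x)
        = setEntry (MeasurableEquiv.curry ℕ (Fin m) Bool f) i c x := by
    intro f x
    funext j d
    by_cases h : j = i ∧ d = c
    · obtain ⟨rfl, rfl⟩ := h
      rw [setEntry_same]
      exact Function.update_self ..
    · rw [setEntry_of_ne _ _ h]
      exact Function.update_of_ne (fun h' => h ⟨congrArg Prod.fst h', congrArg Prod.snd h'⟩) ..
  have key := infinitePi_inter_eval_of_invariant
    (fun p : ℕ × Fin m => bernoulliMeasure true false (θ p.2)) (i, c)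
    (E := MeasurableEquiv.curry ℕ (Fin m) Bool ⁻¹' E)
    ((MeasurableEquiv.curry ℕ (Fin m) Bool).measurable hE)
    (fun f x => by simp only [Set.mem_preimage, hup, hinv])
    (measurableSet_singleton true)
  rw [measureReal_def, measureReal_def, hflat, MeasurableEquiv.map_apply,
    MeasurableEquiv.map_apply]
  have hset : (MeasurableEquiv.curry ℕ (Fin m) Bool) ⁻¹' (E ∩ {ω | ω i c = true})
      = (MeasurableEquiv.curry ℕ (Fin m) Bool ⁻¹' E) ∩ {f | f (i, c) ∈ ({true} : Set Bool)} := by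
    ext f; rfl
  rw [hset, key, ENNReal.toReal_mul, ← measureReal_def (bernoulliMeasure true false (θ c))]
  congr 1
  exact bernoulliMeasure_real_apply_of_mem_of_notMem _ (measurableSet_singleton _)
    (by simp) (by simp)

lemma productLaw_real_true (θ : Fin m → unitInterval) (c : Fin m) :
    (productLaw θ).real {p | p c = true} = θ c := by
  have h := (measurePreserving_eval_infinitePi
    (fun c => bernoulliMeasure true false (θ c)) c).measureReal_preimage
      (measurableSet_singleton true).nullMeasurableSet
  refine h.trans ?_
  exact bernoulliMeasure_real_apply_of_mem_of_notMem _ (measurableSet_singleton _)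
    (by simp) (by simp)

lemma productLaw_missed (θ : Fin m → unitInterval) (S : Finset (Fin m))
    (hS : ∀ c ∈ S, θ c = 0) : ∀ᵐ p ∂productLaw θ, p ∈ missed S := by
  have h : ∀ c ∈ S, ∀ᵐ p ∂productLaw θ, ¬ p c = true := by
    intro c hc
    rw [ae_iff]
    simp only [not_not]
    have := productLaw_real_true θ c
    rw [hS c hc, Set.Icc.coe_zero, measureReal_def, ENNReal.toReal_eq_zero_iff] at this
    exact this.resolve_right (measure_ne_top _ _)
  filter_upwards [(ae_ball_iff S.countable_toSet).2 h] with p hp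
  rintro ⟨c, hc, hpc⟩
  exact hp c hc hpc

lemma missRate_productLaw (θ : Fin m → unitInterval) (S : Finset (Fin m))
    (hS : ∀ c ∈ S, θ c = 0) : missRate (productLaw θ) S = 1 := by
  have h := prob_compl_eq_zero_iff₀ (μ := productLaw θ) (s := missed S)
    (Set.toFinite _).measurableSet.nullMeasurableSet |>.1 (productLaw_missed θ S hS)
  rw [missRate, measureReal_def, h, ENNReal.toReal_one]

/-- If the committee never solves a task, then conditioning on its failure changes nothing. -/
lemma failureLaw_productLaw (θ : Fin m → unitInterval) (S : Finset (Fin m))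
    (hS : ∀ c ∈ S, θ c = 0) : failureLaw (productLaw θ) S = productLaw θ := by
  have h := prob_compl_eq_zero_iff₀ (μ := productLaw θ) (s := missed S)
    (Set.toFinite _).measurableSet.nullMeasurableSet |>.1 (productLaw_missed θ S hS)
  rw [failureLaw, ProbabilityTheory.cond,
    Measure.restrict_eq_self_of_ae_mem (productLaw_missed θ S hS), h, inv_one, one_smul]

lemma rescueRate_productLaw (θ : Fin m → unitInterval) (S : Finset (Fin m))
    (hS : ∀ c ∈ S, θ c = 0) (c : Fin m) : rescueRate (productLaw θ) S c = θ c := by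
  rw [rescueRate, failureLaw_productLaw θ S hS, productLaw_real_true]

lemma runLaw_productLaw {R : Type*} [MeasurableSpace R] (alg : Algorithm m R)
    (θ : Fin m → unitInterval) (S : Finset (Fin m)) (hS : ∀ c ∈ S, θ c = 0) :
    alg.runLaw (productLaw θ) S = alg.seedLaw.prod (taskLaw θ) := by
  simp only [Algorithm.runLaw, failureLaw_productLaw θ S hS, taskLaw]

/-! ### The answer history as a Markov chain -/

/-- Histories form a countable set and carry the discrete σ-algebra. -/
instance : MeasurableSpace (List Bool) := ⊤

instance : DiscreteMeasurableSpace (List Bool) := ⟨fun _ => trivial⟩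

namespace Algorithm

variable {R : Type*} [MeasurableSpace R] (alg : Algorithm m R)

lemma answers_succ_of_query {r : R} {ω : ℕ → Profile m} {t i : ℕ} {c : Fin m}
    (h : alg.move r (alg.answers r ω t) = Move.query i c) :
    alg.answers r ω (t + 1) = ω i c :: alg.answers r ω t := by
  rw [answers, h]

lemma answers_succ_of_output {r : R} {ω : ℕ → Profile m} {t : ℕ} {c : Fin m}
    (h : alg.move r (alg.answers r ω t) = Move.output c) :
    alg.answers r ω (t + 1) = alg.answers r ω t := by
  rw [answers, h]

lemma answers_succ_eq_iff {r : R} {ω : ℕ → Profile m} {t : ℕ} {h : List Bool} :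
    alg.answers r ω (t + 1) = h ↔
      (∃ c, alg.answers r ω t = h ∧ alg.move r h = Move.output c) ∨
      ∃ h' i c, alg.answers r ω t = h' ∧ alg.move r h' = Move.query i c ∧ ω i c :: h' = h := by
  cases hm : alg.move r (alg.answers r ω t) with
  | query i c =>
    rw [alg.answers_succ_of_query hm]
    constructor
    · exact fun he => Or.inr ⟨_, i, c, rfl, hm, he⟩
    · rintro (⟨d, rfl, hd⟩ | ⟨h', j, d, rfl, hd, he⟩)
      · simp [hm] at hd
      · rw [hm] at hd
        cases hd
        exact he
  | output c =>
    rw [alg.answers_succ_of_output hm]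
    constructor
    · rintro rfl
      exact Or.inl ⟨c, rfl, hm⟩
    · rintro (⟨d, he, -⟩ | ⟨h', j, d, rfl, hd, he⟩)
      · exact he
      · simp [hm] at hd

lemma length_answers_le (r : R) (ω : ℕ → Profile m) (t : ℕ) :
    (alg.answers r ω t).length ≤ t := by
  induction t with
  | zero => simp [answers]
  | succ t ih =>
    cases hm : alg.move r (alg.answers r ω t) with
    | query i c => rw [alg.answers_succ_of_query hm, List.length_cons]; omega
    | output c => rw [alg.answers_succ_of_output hm]; omega

lemma measurable_answers (t : ℕ) :
    Measurable fun x : R × (ℕ → Profile m) => alg.answers x.1 x.2 t := by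
  induction t with
  | zero => exact measurable_const
  | succ t ih =>
    refine measurable_to_countable' fun h => ?_
    have hset : (fun x : R × (ℕ → Profile m) => alg.answers x.1 x.2 (t + 1)) ⁻¹' {h}
        = (⋃ c, {x | alg.answers x.1 x.2 t = h} ∩ Prod.fst ⁻¹' {r | alg.move r h = Move.output c})
          ∪ ⋃ h', ⋃ i, ⋃ c, {x | alg.answers x.1 x.2 t = h'} ∩
              (Prod.fst ⁻¹' {r | alg.move r h' = Move.query i c} ∩
                {x | x.2 i c ∈ {b | b :: h' = h}}) := by
      ext x
      simp [answers_succ_eq_iff]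
    have hans : ∀ h, MeasurableSet {x : R × (ℕ → Profile m) | alg.answers x.1 x.2 t = h} :=
      fun h => ih (measurableSet_singleton h)
    rw [hset]
    refine (MeasurableSet.iUnion fun c => (hans h).inter
      (measurable_fst (alg.measurableSet_move _ _))).union
      (MeasurableSet.iUnion fun h' => MeasurableSet.iUnion fun i => MeasurableSet.iUnion fun c =>
        (hans h').inter ((measurable_fst (alg.measurableSet_move _ _)).inter ?_))
    exact (show Measurable fun x : R × (ℕ → Profile m) => x.2 i c by fun_prop)
      (Set.toFinite _).measurableSet

/-- A quantity determined by the seed and the answer history is measurable as soon as it is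
measurable in the seed for each fixed history. -/
lemma measurable_comp_answers {β : Type*} [MeasurableSpace β] {u : R → List Bool → β}
    (hu : ∀ h, Measurable fun r => u r h) (t : ℕ) :
    Measurable fun x : R × (ℕ → Profile m) => u x.1 (alg.answers x.1 x.2 t) :=
  (measurable_from_prod_countable_left (f := fun z : R × List Bool => u z.1 z.2) hu).comp
    (measurable_fst.prodMk (alg.measurable_answers t))

lemma measurable_answers_right (r : R) (t : ℕ) : Measurable fun ω => alg.answers r ω t :=
  (alg.measurable_answers t).comp measurable_prodMk_left

/-- Only finitely many histories are possible at time `t`, so any real function of the history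
is bounded. -/
lemma integrable_comp_answers (F : List Bool → ℝ) (r : R) (t : ℕ)
    (P : Measure (ℕ → Profile m)) [IsFiniteMeasure P] :
    Integrable (fun ω => F (alg.answers r ω t)) P := by
  obtain ⟨C, hC⟩ := ((List.finite_length_le Bool t).image fun h => |F h|).bddAbove
  refine Integrable.of_bound ((measurable_from_top (f := F)).comp
    (alg.measurable_answers_right r t)).aestronglyMeasurable C (ae_of_all _ fun ω => ?_)
  exact hC ⟨_, alg.length_answers_le r ω t, rfl⟩

open Classical in
/-- The answer already given along the history `h` to the query `(i, c)`, if that query has been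
made. -/
noncomputable def lookup (alg : Algorithm m R) (r : R) : List Bool → ℕ → Fin m → Option Bool
  | [], _, _ => none
  | b :: h, i, c => if alg.move r h = Move.query i c then some b else alg.lookup r h i c

lemma entry_eq_of_lookup {r : R} {ω : ℕ → Profile m} {t i : ℕ} {c : Fin m} {b : Bool}
    (h : alg.lookup r (alg.answers r ω t) i c = some b) : ω i c = b := by
  induction t with
  | zero => simp [answers, lookup] at h
  | succ t ih =>
    cases hm : alg.move r (alg.answers r ω t) with
    | output d => rw [alg.answers_succ_of_output hm] at h; exact ih h
    | query j d =>
      rw [alg.answers_succ_of_query hm, lookup, hm] at h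
      split_ifs at h with he
      · cases he
        exact Option.some.inj h
      · exact ih h

/-- A history in which the query `(i, c)` has not been made does not depend on that entry. -/
lemma answers_setEntry {r : R} {ω : ℕ → Profile m} {t i : ℕ} {c : Fin m} (x : Bool)
    (h : alg.lookup r (alg.answers r ω t) i c = none) :
    alg.answers r (setEntry ω i c x) t = alg.answers r ω t := by
  induction t with
  | zero => rfl
  | succ t ih =>
    cases hm : alg.move r (alg.answers r ω t) with
    | output d =>
      rw [alg.answers_succ_of_output hm] at h ⊢
      rw [← ih h] at hm
      rw [alg.answers_succ_of_output hm, ih h]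
    | query j d =>
      rw [alg.answers_succ_of_query hm, lookup, hm] at h
      split_ifs at h with he
      have hm' := hm
      rw [← ih h] at hm'
      rw [alg.answers_succ_of_query hm, alg.answers_succ_of_query hm', ih h, setEntry_of_ne]
      rintro ⟨rfl, rfl⟩
      exact he rfl

lemma setEntry_setEntry_self (ω : ℕ → Profile m) (i : ℕ) (c : Fin m) (x : Bool) :
    setEntry (setEntry ω i c x) i c (ω i c) = ω := by
  simp [setEntry]

/-- The transition operator of the answer history when the entries are independent with success
probabilities `θ`: a repeated query returns the known answer, a fresh query to `c` a
`θ c`-biased coin. -/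
noncomputable def step (r : R) (θ : Fin m → unitInterval) (F : List Bool → ℝ) (h : List Bool) : ℝ :=
  match alg.move r h with
  | Move.output _ => F h
  | Move.query i c =>
    match alg.lookup r h i c with
    | some b => F (b :: h)
    | none => θ c * F (true :: h) + (1 - θ c) * F (false :: h)

lemma integral_eq_sum_answers (r : R) (t : ℕ) (P : Measure (ℕ → Profile m))
    {f : (ℕ → Profile m) → ℝ} (hf : Integrable f P) :
    ∫ ω, f ω ∂P = ∑ h ∈ (List.finite_length_le Bool t).toFinset,
      ∫ ω in {ω | alg.answers r ω t = h}, f ω ∂P := by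
  rw [← integral_biUnion_finset]
  · rw [← setIntegral_univ]
    congr 2
    symm
    rw [Set.eq_univ_iff_forall]
    intro ω
    simpa using alg.length_answers_le r ω t
  · exact fun h _ => alg.measurable_answers_right r t (measurableSet_singleton h)
  · intro h _ h' _ hne
    exact Set.disjoint_left.2 fun ω hω hω' => hne (hω.symm.trans hω')
  · exact fun h _ => hf.integrableOn

/-- The answer history is a Markov chain with transition operator `step`. -/
lemma integral_answers_succ (r : R) (θ : Fin m → unitInterval) (F : List Bool → ℝ) (t : ℕ) :
    ∫ ω, F (alg.answers r ω (t + 1)) ∂taskLaw θ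
      = ∫ ω, alg.step r θ F (alg.answers r ω t) ∂taskLaw θ := by
  rw [alg.integral_eq_sum_answers r t _ (alg.integrable_comp_answers F r (t + 1) _),
    alg.integral_eq_sum_answers r t _ (alg.integrable_comp_answers _ r t _)]
  refine Finset.sum_congr rfl fun h _ => ?_
  set E : Set (ℕ → Profile m) := {ω | alg.answers r ω t = h}
  have hE : MeasurableSet E := alg.measurable_answers_right r t (measurableSet_singleton h)
  cases hm : alg.move r h with
  | output c =>
    refine setIntegral_congr_fun hE fun ω hω => ?_
    have hω' : alg.answers r ω t = h := hω
    have hm' := hm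
    rw [← hω'] at hm'
    simp only [alg.answers_succ_of_output hm', step, hm']
  | query i c =>
    cases hl : alg.lookup r h i c with
    | some b =>
      refine setIntegral_congr_fun hE fun ω hω => ?_
      have hω' : alg.answers r ω t = h := hω
      have hb : ω i c = b := alg.entry_eq_of_lookup (by rw [hω', hl])
      have hm' := hm
      rw [← hω'] at hm'
      simp only [alg.answers_succ_of_query hm', step, hω', hm, hl, hb]
    | none =>
      have hsub : ∀ ω x, ω ∈ E → setEntry ω i c x ∈ E := by
        intro ω x hω
        have hω' : alg.answers r ω t = h := hω
        have := alg.answers_setEntry x (ω := ω) (t := t) (r := r) (by rw [hω', hl])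
        exact this.trans hω'
      have hinv : ∀ ω x, setEntry ω i c x ∈ E ↔ ω ∈ E := by
        refine fun ω x => ⟨fun hω => ?_, hsub ω x⟩
        rw [← setEntry_setEntry_self ω i c x]
        exact hsub _ _ hω
      have hT : MeasurableSet {ω : ℕ → Profile m | ω i c = true} :=
        (show Measurable fun ω : ℕ → Profile m => ω i c by fun_prop) (measurableSet_singleton true)
      have hval : ∀ ω ∈ E, F (alg.answers r ω (t + 1)) = F (ω i c :: h) := by
        intro ω hω
        have hω' : alg.answers r ω t = h := hω
        rw [alg.answers_succ_of_query (by rw [hω', hm]), hω']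
      have htrue := taskLaw_real_inter_entry θ i c hE hinv
      have hfalse : (taskLaw θ).real (E \ {ω | ω i c = true})
          = (taskLaw θ).real E * (1 - θ c) := by
        have := measureReal_inter_add_sdiff (μ := taskLaw θ) (s := E) hT
        linarith
      rw [← integral_inter_add_sdiff hT (alg.integrable_comp_answers F r (t + 1) _).integrableOn,
        setIntegral_congr_fun (g := fun _ => F (true :: h)) (hE.inter hT),
        setIntegral_congr_fun (g := fun _ => F (false :: h)) (hE.diff hT),
        setIntegral_congr_fun
          (g := fun _ => θ c * F (true :: h) + (1 - θ c) * F (false :: h)) hE]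
      · simp only [setIntegral_const, htrue, hfalse, smul_eq_mul]
        ring
      · intro ω hω
        have hω' : alg.answers r ω t = h := hω
        simp only [hω', step, hm, hl]
      · intro ω hω
        have hb : ω i c = false := by simpa using hω.2
        simp only [hval ω hω.1, hb]
      · intro ω hω
        have hb : ω i c = true := hω.2
        simp only [hval ω hω.1, hb]

end Algorithm

/-! ### The Gibbs variational inequality along a run -/

/-- Jensen's inequality for the exponential on two points, in logarithmic form. -/
lemma two_point_jensen {p : ℝ} (hp0 : 0 ≤ p) (hp1 : p ≤ 1) (x y : ℝ) :
    p * x + (1 - p) * y ≤ Real.log (p * Real.exp x + (1 - p) * Real.exp y) := by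
  have h := convexOn_exp.2 (Set.mem_univ x) (Set.mem_univ y) hp0 (sub_nonneg.2 hp1) (by ring)
  simp only [smul_eq_mul] at h
  rw [Real.le_log_iff_exp_le ((Real.exp_pos _).trans_le h)]
  exact h

/-- The Gibbs variational inequality for two coins, with the relative entropy bounded by the
`χ²`-divergence. -/
lemma two_point_gibbs {p q : ℝ} (hp0 : 0 < p) (hp1 : p < 1) (hq0 : 0 < q) (hq1 : q < 1)
    (x y : ℝ) :
    p * x + (1 - p) * y
      ≤ (p - q) ^ 2 / (q * (1 - q)) + Real.log (q * Real.exp x + (1 - q) * Real.exp y) := by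
  have hp1' : 0 < 1 - p := sub_pos.2 hp1
  have hq1' : 0 < 1 - q := sub_pos.2 hq1
  -- Tilting the values by the log-likelihood ratios turns `p`-averages into `q`-averages.
  have h := two_point_jensen hp0.le hp1.le (x + Real.log (q / p)) (y + Real.log ((1 - q) / (1 - p)))
  have hz : p * Real.exp (x + Real.log (q / p))
      + (1 - p) * Real.exp (y + Real.log ((1 - q) / (1 - p)))
      = q * Real.exp x + (1 - q) * Real.exp y := by
    rw [Real.exp_add, Real.exp_add, Real.exp_log (by positivity), Real.exp_log (by positivity)]
    field_simp
  rw [hz] at h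
  have h1 : 1 - p / q ≤ Real.log (q / p) := by
    simpa using Real.one_sub_inv_le_log_of_pos (div_pos hq0 hp0)
  have h2 : 1 - (1 - p) / (1 - q) ≤ Real.log ((1 - q) / (1 - p)) := by
    simpa using Real.one_sub_inv_le_log_of_pos (div_pos hq1' hp1')
  have h3 : p * (1 - p / q) + (1 - p) * (1 - (1 - p) / (1 - q))
      = -((p - q) ^ 2 / (q * (1 - q))) := by
    field_simp
    ring
  nlinarith [mul_le_mul_of_nonneg_left h1 hp0.le, mul_le_mul_of_nonneg_left h2 hp1'.le]

namespace Algorithm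

variable {R : Type*} [MeasurableSpace R] (alg : Algorithm m R)

open Classical in
/-- Indicator that the next move after the history `h` is a query to the expert `a`. -/
noncomputable def queriesNext (a : Fin m) (r : R) (h : List Bool) : ℝ :=
  if ∃ i, alg.move r h = Move.query i a then 1 else 0

lemma queriesNext_nonneg (a : Fin m) (r : R) (h : List Bool) : 0 ≤ alg.queriesNext a r h := by
  unfold queriesNext; split_ifs <;> simp

lemma step_pos {r : R} {θ : Fin m → unitInterval} {F : List Bool → ℝ} (hF : ∀ h, 0 < F h)
    (h : List Bool) : 0 < alg.step r θ F h := by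
  unfold step
  split
  · exact hF _
  · split
    · exact hF _
    · rename_i c _ _ _
      rcases (θ c).2.1.eq_or_lt with h0 | h0
      · rw [← h0]; simpa using hF _
      · exact add_pos_of_pos_of_nonneg (mul_pos h0 (hF _))
          (mul_nonneg (sub_nonneg.2 (θ c).2.2) (hF _).le)

/-- One step of the Gibbs variational inequality: only a query to the expert `a`, the one expert
whose success probability differs between `θ` and `θ'`, costs anything. -/
lemma step_le_log_step {θ θ' : Fin m → unitInterval} {a : Fin m} {K : ℝ}
    (hθ : ∀ c, c ≠ a → θ c = θ' c)
    (hp0 : 0 < (θ a : ℝ)) (hp1 : (θ a : ℝ) < 1) (hq0 : 0 < (θ' a : ℝ)) (hq1 : (θ' a : ℝ) < 1)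
    (hK : ((θ a : ℝ) - θ' a) ^ 2 / (θ' a * (1 - θ' a)) ≤ K)
    (r : R) (g : List Bool → ℝ) (h : List Bool) :
    alg.step r θ g h
      ≤ K * alg.queriesNext a r h + Real.log (alg.step r θ' (fun h => Real.exp (g h)) h) := by
  have hK0 : 0 ≤ K :=
    (div_nonneg (sq_nonneg _) (mul_nonneg hq0.le (sub_nonneg.2 hq1.le))).trans hK
  have hnonneg := mul_nonneg hK0 (alg.queriesNext_nonneg a r h)
  unfold step
  cases hm : alg.move r h with
  | output c => simpa using hnonneg
  | query i c =>
    cases hl : alg.lookup r h i c with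
    | some b => simpa [hl] using hnonneg
    | none =>
      simp only [hl]
      by_cases hc : c = a
      · subst hc
        have h1 : alg.queriesNext c r h = 1 := if_pos ⟨i, hm⟩
        rw [h1, mul_one]
        exact (two_point_gibbs hp0 hp1 hq0 hq1 _ _).trans (by gcongr)
      · rw [hθ c hc]
        exact (two_point_jensen (θ' c).2.1 (θ' c).2.2 _ _).trans (le_add_of_nonneg_left hnonneg)

/-- The Gibbs variational inequality for the answer history at time `t`: the information that the
history carries for telling `θ` from `θ'` is at most `K` per query to `a`. -/
lemma gibbs_answers {θ θ' : Fin m → unitInterval} {a : Fin m} {K : ℝ}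
    (hθ : ∀ c, c ≠ a → θ c = θ' c)
    (hp0 : 0 < (θ a : ℝ)) (hp1 : (θ a : ℝ) < 1) (hq0 : 0 < (θ' a : ℝ)) (hq1 : (θ' a : ℝ) < 1)
    (hK : ((θ a : ℝ) - θ' a) ^ 2 / (θ' a * (1 - θ' a)) ≤ K)
    (r : R) (t : ℕ) (g : List Bool → ℝ) :
    ∫ ω, g (alg.answers r ω t) ∂taskLaw θ
      ≤ K * ∑ s ∈ Finset.range t, ∫ ω, alg.queriesNext a r (alg.answers r ω s) ∂taskLaw θ
        + Real.log (∫ ω, Real.exp (g (alg.answers r ω t)) ∂taskLaw θ') := by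
  induction t generalizing g with
  | zero => simp [answers]
  | succ t ih =>
    have hint := fun (F : List Bool → ℝ) =>
      alg.integrable_comp_answers F r t (taskLaw θ)
    have hstep := fun h => alg.step_le_log_step hθ hp0 hp1 hq0 hq1 hK r g h
    have hpos := fun h =>
      alg.step_pos (r := r) (θ := θ') (F := fun h => Real.exp (g h)) (fun h => Real.exp_pos _) h
    have hih := ih fun h => Real.log (alg.step r θ' (fun h => Real.exp (g h)) h)
    simp only [Real.exp_log (hpos _)] at hih
    rw [← alg.integral_answers_succ r θ' (fun h => Real.exp (g h)) t] at hih
    rw [alg.integral_answers_succ r θ g t, Finset.sum_range_succ, mul_add]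
    have hmono := integral_mono (hint (alg.step r θ g))
      (((hint (alg.queriesNext a r)).const_mul K).add
        (hint fun h => Real.log (alg.step r θ' (fun h => Real.exp (g h)) h)))
      (fun ω => hstep (alg.answers r ω t))
    simp only [Pi.add_apply] at hmono
    rw [integral_add ((hint _).const_mul K) (hint fun h => Real.log (alg.step r θ' _ h)),
      integral_const_mul] at hmono
    linarith

/-! ### Averaging over the seed -/

lemma measurable_queriesNext (a : Fin m) (h : List Bool) :
    Measurable fun r => alg.queriesNext a r h := by
  classical
  refine Measurable.ite ?_ measurable_const measurable_const
  rw [Set.ofPred_exists]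
  exact MeasurableSet.iUnion fun i => alg.measurableSet_move h _

open Classical in
lemma measurableSet_queries (a : Fin m) (t : ℕ) :
    MeasurableSet {x : R × (ℕ → Profile m) | ∃ i, alg.moveAt x.1 x.2 t = Move.query i a} := by
  have h := alg.measurable_comp_answers (alg.measurable_queriesNext a) t
    (measurableSet_singleton (1 : ℝ))
  convert h using 1
  ext x
  simp [queriesNext, moveAt]

open Classical in
lemma measurableSet_outputs (a : Fin m) (t : ℕ) :
    MeasurableSet {x : R × (ℕ → Profile m) | alg.moveAt x.1 x.2 t = Move.output a} := by
  have h := alg.measurable_comp_answers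
    (u := fun r h => if alg.move r h = Move.output a then (1 : ℝ) else 0)
    (fun h => Measurable.ite (alg.measurableSet_move h _) measurable_const measurable_const) t
    (measurableSet_singleton (1 : ℝ))
  convert h using 1
  ext x
  simp [moveAt]

lemma integrable_prod_comp_answers {u : R → List Bool → ℝ} (hu : ∀ h, Measurable fun r => u r h)
    {C : ℝ} (hC : ∀ r h, |u r h| ≤ C) (t : ℕ) (P : Measure (R × (ℕ → Profile m)))
    [IsFiniteMeasure P] :
    Integrable (fun x : R × (ℕ → Profile m) => u x.1 (alg.answers x.1 x.2 t)) P :=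
  Integrable.of_bound (alg.measurable_comp_answers hu t).aestronglyMeasurable C
    (ae_of_all _ fun _ => hC _ _)

/-- If the event "the algorithm has returned `a` by time `T`" has different probabilities under
the two laws, then the algorithm queries `a` often. The test function of the variational
inequality is `-b` on this event and `b` off it. -/
lemma change_of_law {θ θ' : Fin m → unitInterval} {a : Fin m} {K : ℝ}
    (hθ : ∀ c, c ≠ a → θ c = θ' c)
    (hp0 : 0 < (θ a : ℝ)) (hp1 : (θ a : ℝ) < 1) (hq0 : 0 < (θ' a : ℝ)) (hq1 : (θ' a : ℝ) < 1)
    (hK : ((θ a : ℝ) - θ' a) ^ 2 / (θ' a * (1 - θ' a)) ≤ K) (T : ℕ) (b : ℝ) :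
    b * (1 - 2 * (alg.seedLaw.prod (taskLaw θ)).real
        {x | alg.moveAt x.1 x.2 T = Move.output a})
      ≤ K * ∑ s ∈ Finset.range T, (alg.seedLaw.prod (taskLaw θ)).real
          {x | ∃ i, alg.moveAt x.1 x.2 s = Move.query i a}
        + (Real.exp b * (1 - (alg.seedLaw.prod (taskLaw θ')).real
              {x | alg.moveAt x.1 x.2 T = Move.output a})
          + Real.exp (-b) * (alg.seedLaw.prod (taskLaw θ')).real
              {x | alg.moveAt x.1 x.2 T = Move.output a} - 1) := by
  classical
  have := alg.isProbabilityMeasure_seedLaw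
  set E : Set (R × (ℕ → Profile m)) := {x | alg.moveAt x.1 x.2 T = Move.output a}
  have hE : MeasurableSet E := alg.measurableSet_outputs a T
  set g : R → List Bool → ℝ := fun r h => if alg.move r h = Move.output a then -b else b with hg
  have hgm : ∀ h, Measurable fun r => g r h := fun h =>
    Measurable.ite (alg.measurableSet_move h _) measurable_const measurable_const
  have hgb : ∀ r h, |g r h| ≤ |b| := by
    intro r h; simp only [hg]; split_ifs <;> simp
  have hgi := fun P [IsFiniteMeasure P] =>
    alg.integrable_prod_comp_answers hgm hgb T P
  have hei : ∀ P [IsFiniteMeasure P], Integrable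
      (fun x : R × (ℕ → Profile m) => Real.exp (g x.1 (alg.answers x.1 x.2 T))) P := fun P _ =>
    alg.integrable_prod_comp_answers (u := fun r h => Real.exp (g r h))
      (fun h => (hgm h).exp) (C := Real.exp |b|)
      (fun r h => by rw [Real.abs_exp]; exact Real.exp_le_exp.2 ((le_abs_self _).trans (hgb r h)))
      T P
  have hqi := fun s P [IsFiniteMeasure P] =>
    alg.integrable_prod_comp_answers (alg.measurable_queriesNext a) (C := 1)
      (fun r h => by unfold queriesNext; split_ifs <;> simp) s P
  -- For each seed, `log X ≤ X - 1` makes the inequality linear, so that it can be averaged.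
  have hseed : ∀ r, ∫ ω, g r (alg.answers r ω T) ∂taskLaw θ
      ≤ K * ∑ s ∈ Finset.range T, ∫ ω, alg.queriesNext a r (alg.answers r ω s) ∂taskLaw θ
        + (∫ ω, Real.exp (g r (alg.answers r ω T)) ∂taskLaw θ' - 1) := by
    intro r
    refine (alg.gibbs_answers hθ hp0 hp1 hq0 hq1 hK r T (g r)).trans ?_
    gcongr
    refine Real.log_le_sub_one_of_pos ?_
    exact integral_exp_pos (alg.integrable_comp_answers (fun h => Real.exp (g r h)) r T _)
  have hsumi : Integrable (fun r => ∑ s ∈ Finset.range T,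
      ∫ ω, alg.queriesNext a r (alg.answers r ω s) ∂taskLaw θ) alg.seedLaw :=
    integrable_finsetSum _ fun s _ => (hqi s (alg.seedLaw.prod (taskLaw θ))).integral_prod_left
  have hexpi : Integrable (fun r => ∫ ω, Real.exp (g r (alg.answers r ω T)) ∂taskLaw θ')
      alg.seedLaw := (hei (alg.seedLaw.prod (taskLaw θ'))).integral_prod_left
  have hexpi' : Integrable (fun r => ∫ ω, Real.exp (g r (alg.answers r ω T)) ∂taskLaw θ' - 1)
      alg.seedLaw := hexpi.sub (integrable_const 1)
  have hmono := integral_mono (hgi (alg.seedLaw.prod (taskLaw θ))).integral_prod_left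
    ((hsumi.const_mul K).add hexpi') hseed
  simp only [Pi.add_apply] at hmono
  rw [integral_add (hsumi.const_mul K) hexpi',
    integral_sub hexpi (integrable_const 1), integral_const_mul,
    integral_finsetSum _ fun s _ => (hqi s (alg.seedLaw.prod (taskLaw θ))).integral_prod_left,
    ← integral_prod _ (hgi (alg.seedLaw.prod (taskLaw θ))),
    ← integral_prod _ (hei (alg.seedLaw.prod (taskLaw θ')))] at hmono
  simp only [← integral_prod _ (hqi _ (alg.seedLaw.prod (taskLaw θ)))] at hmono
  have hgE : ∀ x : R × (ℕ → Profile m),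
      g x.1 (alg.answers x.1 x.2 T) = b - 2 * b * E.indicator 1 x := by
    intro x
    by_cases hx : alg.move x.1 (alg.answers x.1 x.2 T) = Move.output a
    · have hxE : x ∈ E := hx
      simp only [hg, if_pos hx, Set.indicator_of_mem hxE, Pi.one_apply]; ring
    · have hxE : x ∉ E := hx
      simp only [hg, if_neg hx, Set.indicator_of_notMem hxE]; ring
  have heE : ∀ x : R × (ℕ → Profile m), Real.exp (g x.1 (alg.answers x.1 x.2 T))
      = Real.exp b - (Real.exp b - Real.exp (-b)) * E.indicator 1 x := by
    intro x
    by_cases hx : alg.move x.1 (alg.answers x.1 x.2 T) = Move.output a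
    · have hxE : x ∈ E := hx
      simp only [hg, if_pos hx, Set.indicator_of_mem hxE, Pi.one_apply]; ring
    · have hxE : x ∉ E := hx
      simp only [hg, if_neg hx, Set.indicator_of_notMem hxE]; ring
  have hqE : ∀ s, ∫ x, alg.queriesNext a x.1 (alg.answers x.1 x.2 s)
        ∂(alg.seedLaw.prod (taskLaw θ))
      = (alg.seedLaw.prod (taskLaw θ)).real
          {x | ∃ i, alg.moveAt x.1 x.2 s = Move.query i a} := by
    intro s
    rw [← integral_indicator_one (alg.measurableSet_queries a s)]
    rfl
  have hind : ∀ P : Measure (R × (ℕ → Profile m)), IsFiniteMeasure P →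
      Integrable (E.indicator (1 : R × (ℕ → Profile m) → ℝ)) P :=
    fun P _ => (integrable_const (1 : ℝ)).indicator hE
  simp only [heE, hqE] at hmono
  simp only [hgE] at hmono
  rw [integral_sub (integrable_const _) ((hind _ inferInstance).const_mul _),
    integral_sub (integrable_const _) ((hind _ inferInstance).const_mul _),
    integral_const_mul, integral_const_mul, integral_indicator_one hE,
    integral_indicator_one hE] at hmono
  simp only [integral_const, probReal_univ, one_smul] at hmono
  linarith

/-! ### Queries to a single expert -/

lemma moveAt_succ_of_output {r : R} {ω : ℕ → Profile m} {t : ℕ} {c : Fin m}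
    (h : alg.moveAt r ω t = Move.output c) : alg.moveAt r ω (t + 1) = Move.output c := by
  rw [moveAt, alg.answers_succ_of_output h]
  exact h

lemma moveAt_of_output_of_le {r : R} {ω : ℕ → Profile m} {s t : ℕ} {c : Fin m}
    (h : alg.moveAt r ω s = Move.output c) (hst : s ≤ t) : alg.moveAt r ω t = Move.output c := by
  induction t, hst using Nat.le_induction with
  | base => exact h
  | succ t _ ih => exact alg.moveAt_succ_of_output ih

lemma Returns.unique {alg : Algorithm m R} {r : R} {ω : ℕ → Profile m} {c d : Fin m}
    (hc : alg.Returns r ω c) (hd : alg.Returns r ω d) : c = d := by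
  obtain ⟨s, hs⟩ := hc
  obtain ⟨t, ht⟩ := hd
  have h1 := alg.moveAt_of_output_of_le hs (le_max_left s t)
  rw [alg.moveAt_of_output_of_le ht (le_max_right s t)] at h1
  cases h1
  rfl

lemma measurableSet_returns (a : Fin m) :
    MeasurableSet {x : R × (ℕ → Profile m) | alg.Returns x.1 x.2 a} := by
  have h : {x : R × (ℕ → Profile m) | alg.Returns x.1 x.2 a}
      = ⋃ t, {x | alg.moveAt x.1 x.2 t = Move.output a} := by
    ext x; simp [Returns]
  rw [h]
  exact MeasurableSet.iUnion fun t => alg.measurableSet_outputs a t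

lemma tendsto_measureReal_outputs (a : Fin m) (P : Measure (R × (ℕ → Profile m)))
    [IsFiniteMeasure P] :
    Filter.Tendsto (fun t => P.real {x | alg.moveAt x.1 x.2 t = Move.output a}) Filter.atTop
      (nhds (P.real {x | alg.Returns x.1 x.2 a})) := by
  have h : {x : R × (ℕ → Profile m) | alg.Returns x.1 x.2 a}
      = ⋃ t, {x | alg.moveAt x.1 x.2 t = Move.output a} := by
    ext x; simp [Returns]
  rw [h]
  exact (ENNReal.tendsto_toReal (measure_ne_top P _)).comp
    (tendsto_measure_iUnion_atTop fun s t hst x hx => alg.moveAt_of_output_of_le hx hst)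

open Classical in
/-- The number of queries to the expert `a`, with repetitions. -/
noncomputable def expertQueries (a : Fin m) (r : R) (ω : ℕ → Profile m) : ℝ≥0∞ :=
  ∑' t : ℕ, if ∃ i, alg.moveAt r ω t = Move.query i a then 1 else 0

open Classical in
lemma measurable_expertQueries (a : Fin m) :
    Measurable fun x : R × (ℕ → Profile m) => alg.expertQueries a x.1 x.2 :=
  Measurable.tsum fun t =>
    Measurable.ite (alg.measurableSet_queries a t) measurable_const measurable_const

open Classical in
lemma lintegral_expertQueries (a : Fin m) (P : Measure (R × (ℕ → Profile m))) :
    ∫⁻ x, alg.expertQueries a x.1 x.2 ∂P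
      = ∑' t, P {x | ∃ i, alg.moveAt x.1 x.2 t = Move.query i a} := by
  unfold expertQueries
  rw [lintegral_tsum fun t => (Measurable.ite (alg.measurableSet_queries a t)
    measurable_const measurable_const).aemeasurable]
  refine tsum_congr fun t => ?_
  rw [← lintegral_indicator_one (alg.measurableSet_queries a t)]
  rfl

/-- The queries to different candidates are disjoint events, so their numbers add up to at most
the number of candidate queries. -/
lemma sum_expertQueries_le (A : Finset (Fin m)) (r : R) (ω : ℕ → Profile m) :
    ∑ a ∈ A, alg.expertQueries a r ω ≤ alg.candQueries A r ω := by
  classical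
  unfold expertQueries candQueries
  rw [← Summable.tsum_finsetSum fun _ _ => ENNReal.summable]
  refine ENNReal.tsum_le_tsum fun t => ?_
  cases hm : alg.moveAt r ω t with
  | output c => simp
  | query i c => simp [Finset.sum_ite_eq]

/-- An algorithm that returns `a` with probability at most `δ` when the success probabilities are
`θ`, but with probability at least `1 - δ` after the success probability of `a` alone is changed,
has to query `a` often under `θ`. -/
lemma le_lintegral_expertQueries {θ θ' : Fin m → unitInterval} {a : Fin m} {K : ℝ} (hKpos : 0 < K)
    (hθ : ∀ c, c ≠ a → θ c = θ' c)
    (hp0 : 0 < (θ a : ℝ)) (hp1 : (θ a : ℝ) < 1) (hq0 : 0 < (θ' a : ℝ)) (hq1 : (θ' a : ℝ) < 1)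
    (hK : ((θ a : ℝ) - θ' a) ^ 2 / (θ' a * (1 - θ' a)) ≤ K)
    {δ : ℝ} (hδ0 : 0 < δ) (hδ : δ ≤ 1 / 4)
    (hret : (alg.seedLaw.prod (taskLaw θ)).real {x | alg.Returns x.1 x.2 a} ≤ δ)
    (hret' : 1 - δ ≤ (alg.seedLaw.prod (taskLaw θ')).real {x | alg.Returns x.1 x.2 a}) :
    ENNReal.ofReal ((1 - 2 * δ) * Real.log ((1 - δ) / δ) / K)
      ≤ ∫⁻ x, alg.expertQueries a x.1 x.2 ∂(alg.seedLaw.prod (taskLaw θ)) := by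
  have := alg.isProbabilityMeasure_seedLaw
  set P := alg.seedLaw.prod (taskLaw θ)
  set Q := alg.seedLaw.prod (taskLaw θ')
  set N := ∫⁻ x, alg.expertQueries a x.1 x.2 ∂P with hN
  rcases eq_or_ne N ∞ with hinf | hfin
  · rw [hinf]; exact le_top
  refine ENNReal.ofReal_le_of_le_toReal ?_
  have hratio : 1 ≤ (1 - δ) / δ := by rw [le_div_iff₀ hδ0]; linarith
  set b := Real.log ((1 - δ) / δ) with hb
  have hb0 : 0 ≤ b := Real.log_nonneg hratio
  have heb : Real.exp b = (1 - δ) / δ := Real.exp_log (by linarith)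
  have heb' : Real.exp (-b) = δ / (1 - δ) := by rw [Real.exp_neg, heb, inv_div]
  have hsum : ∀ T, ∑ s ∈ Finset.range T, P.real {x | ∃ i, alg.moveAt x.1 x.2 s = Move.query i a}
      ≤ N.toReal := by
    intro T
    simp only [measureReal_def]
    rw [← ENNReal.toReal_sum fun _ _ => measure_ne_top _ _]
    refine ENNReal.toReal_mono hfin ?_
    rw [hN, lintegral_expertQueries]
    exact ENNReal.sum_le_tsum _
  have hbound : ∀ T, b * (1 - 2 * P.real {x | alg.moveAt x.1 x.2 T = Move.output a})
      ≤ K * N.toReal + (Real.exp b * (1 - Q.real {x | alg.moveAt x.1 x.2 T = Move.output a})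
        + Real.exp (-b) * Q.real {x | alg.moveAt x.1 x.2 T = Move.output a} - 1) := fun T =>
    (alg.change_of_law hθ hp0 hp1 hq0 hq1 hK T b).trans (by gcongr; exact hsum T)
  have hlim := le_of_tendsto_of_tendsto'
    ((((alg.tendsto_measureReal_outputs a P).const_mul 2).const_sub 1).const_mul b)
    ((((((alg.tendsto_measureReal_outputs a Q).const_sub 1).const_mul (Real.exp b)).add
      ((alg.tendsto_measureReal_outputs a Q).const_mul (Real.exp (-b)))).sub_const 1).const_add
        (K * N.toReal)) hbound
  set p := P.real {x | alg.Returns x.1 x.2 a}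
  set q := Q.real {x | alg.Returns x.1 x.2 a}
  -- With `exp b = (1 - δ) / δ`, the remainder is decreasing in `q` and vanishes at `q = 1 - δ`.
  have hrem : Real.exp b * (1 - q) + Real.exp (-b) * q - 1 ≤ 0 := by
    have hle : Real.exp (-b) ≤ Real.exp b := Real.exp_le_exp.2 (by linarith)
    have hzero : Real.exp b * δ + Real.exp (-b) * (1 - δ) = 1 := by
      have h1 : 1 - δ ≠ 0 := by linarith
      rw [heb, heb']
      field_simp
      ring
    nlinarith [mul_nonneg (sub_nonneg.2 hle) (sub_nonneg.2 hret')]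
  rw [div_le_iff₀ hKpos]
  nlinarith [mul_nonneg hb0 (sub_nonneg.2 hret)]

end Algorithm

/-! ### The hard instance -/

lemma quarter_log_le_log_odds {δ : ℝ} (hδ0 : 0 < δ) (hδ : δ ≤ 1 / 4) :
    Real.log (1 / δ) / 4 ≤ (1 - 2 * δ) * Real.log ((1 - δ) / δ) := by
  have hlog : Real.log (1 / δ) / 2 ≤ Real.log ((1 - δ) / δ) := by
    rw [← Real.log_sqrt (by positivity)]
    refine Real.log_le_log (by positivity) (Real.sqrt_le_iff.2 ⟨?_, ?_⟩)
    · exact div_nonneg (by linarith) hδ0.le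
    · rw [div_pow, div_le_div_iff₀ hδ0 (by positivity)]
      nlinarith
  have h0 : 0 ≤ Real.log (1 / δ) := Real.log_nonneg (by rw [le_div_iff₀ hδ0]; linarith)
  nlinarith

/-- The success probability `1/2 - x`, clipped to the unit interval. -/
noncomputable def coin (x : ℝ) : unitInterval := Set.projIcc 0 1 zero_le_one (1 / 2 - x)

lemma coe_coin {x : ℝ} (hx : |x| ≤ 1 / 4) : (coin x : ℝ) = 1 / 2 - x := by
  obtain ⟨h1, h2⟩ := abs_le.1 hx
  exact congrArg Subtype.val
    (Set.projIcc_of_mem (zero_le_one' ℝ) (⟨by linarith, by linarith⟩ : 1 / 2 - x ∈ Set.Icc 0 1))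

open Classical in
/-- Independent experts: a candidate `c ∈ A` succeeds with probability `1/2 - g c`, and all other
experts, in particular the committee, never succeed. -/
noncomputable def instanceRates (A : Finset (Fin m)) (g : Fin m → ℝ) (c : Fin m) : unitInterval :=
  if c ∈ A then coin (g c) else 0

lemma instanceRates_of_mem {A : Finset (Fin m)} {g : Fin m → ℝ} {c : Fin m} (hc : c ∈ A)
    (hg : |g c| ≤ 1 / 4) : (instanceRates A g c : ℝ) = 1 / 2 - g c := by
  rw [instanceRates, if_pos hc, coe_coin hg]

lemma instanceRates_committee {S A : Finset (Fin m)} (hSA : Disjoint S A) (g : Fin m → ℝ) :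
    ∀ c ∈ S, instanceRates A g c = 0 :=
  fun _ hc => if_neg (Finset.disjoint_left.1 hSA hc)

lemma bestRate_instance {S A : Finset (Fin m)} (hA : A.Nonempty) (hSA : Disjoint S A)
    {g : Fin m → ℝ} (hg : ∀ c ∈ A, |g c| ≤ 1 / 4) {best : Fin m} (hbest : best ∈ A)
    (hmin : ∀ c ∈ A, g best ≤ g c) :
    bestRate (productLaw (instanceRates A g)) S A hA = 1 / 2 - g best := by
  have hrate : ∀ c ∈ A, rescueRate (productLaw (instanceRates A g)) S c = 1 / 2 - g c := by
    intro c hc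
    rw [rescueRate_productLaw _ S (instanceRates_committee hSA g),
      instanceRates_of_mem hc (hg c hc)]
  refine le_antisymm (Finset.sup'_le _ _ fun c hc => ?_) ?_
  · rw [hrate c hc]
    linarith [hmin c hc]
  · rw [← hrate best hbest]
    exact Finset.le_sup' _ hbest

/-- A reliable algorithm rarely returns a candidate whose gap exceeds `η`. -/
lemma Algorithm.IsReliable.returns_le {R : Type*} [MeasurableSpace R] {alg : Algorithm m R}
    {S A : Finset (Fin m)} {hA : A.Nonempty} {η δ : ℝ} (halg : alg.IsReliable S A hA η δ)
    {D : Measure (Profile m)} [IsProbabilityMeasure D] (hD : 0 < missRate D S)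
    [IsProbabilityMeasure (alg.runLaw D S)] {a : Fin m}
    (ha : η < gap D S A hA a) :
    (alg.runLaw D S).real {x | alg.Returns x.1 x.2 a} ≤ δ := by
  have h := halg D inferInstance hD
  rw [← ENNReal.ofReal_toReal (measure_ne_top (alg.runLaw D S) _),
    ENNReal.ofReal_le_ofReal_iff ENNReal.toReal_nonneg] at h
  have hcompl := probReal_compl_eq_one_sub (μ := alg.runLaw D S) (alg.measurableSet_returns a)
  have hsub : (alg.runLaw D S).real {x | ∃ c ∈ A, alg.Returns x.1 x.2 c ∧
      bestRate D S A hA - η ≤ rescueRate D S c}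
        ≤ (alg.runLaw D S).real {x | alg.Returns x.1 x.2 a}ᶜ := by
    refine measureReal_mono ?_
    rintro x ⟨c, -, hc, hrate⟩ (hxa : alg.Returns x.1 x.2 a)
    rw [hc.unique hxa] at hrate
    unfold gap at ha
    linarith
  rw [← measureReal_def] at h
  linarith

/-- A reliable algorithm usually returns `a` if every other candidate has a gap exceeding `η`. -/
lemma Algorithm.IsReliable.le_returns {R : Type*} [MeasurableSpace R] {alg : Algorithm m R}
    {S A : Finset (Fin m)} {hA : A.Nonempty} {η δ : ℝ} (halg : alg.IsReliable S A hA η δ)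
    {D : Measure (Profile m)} [IsProbabilityMeasure D] (hD : 0 < missRate D S)
    [IsProbabilityMeasure (alg.runLaw D S)] {a : Fin m}
    (ha : ∀ c ∈ A, c ≠ a → η < gap D S A hA c) :
    1 - δ ≤ (alg.runLaw D S).real {x | alg.Returns x.1 x.2 a} := by
  have h := halg D inferInstance hD
  rw [← ENNReal.ofReal_toReal (measure_ne_top (alg.runLaw D S) _),
    ENNReal.ofReal_le_ofReal_iff ENNReal.toReal_nonneg] at h
  refine h.trans (measureReal_mono ?_)
  rintro x ⟨c, hcA, hc, hrate⟩
  by_cases hca : c = a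
  · exact hca ▸ hc
  · have := ha c hcA hca
    unfold gap at this
    linarith

end Rescue

open Rescue in
theorem theorem4p6 :
    ∃ κ : ℝ, 0 < κ ∧
      ∀ (η δ : ℝ), 0 < η → η < 1 → 0 < δ → δ ≤ 1 / 4 →
      ∀ (m : ℕ) (S A : Finset (Fin m)) (hA : A.Nonempty), Disjoint S A →
      ∀ (cstar : Fin m), cstar ∈ A →
      ∀ (γ : Fin m → ℝ), (∀ a ∈ A, a ≠ cstar → 0 < γ a ∧ γ a ≤ 1 / 4) →
      ∃ D : Measure (Rescue.Profile m), IsProbabilityMeasure D ∧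
        0 < Rescue.missRate D S ∧
        Rescue.gap D S A hA cstar = 0 ∧
        (∀ a ∈ A, a ≠ cstar → Rescue.gap D S A hA a = γ a) ∧
        ∀ (R : Type*) [MeasurableSpace R] (alg : Rescue.Algorithm m R),
          alg.IsReliable S A hA η δ →
          ENNReal.ofReal (κ * ∑ a ∈ A with η < Rescue.gap D S A hA a,
              Real.log (1 / δ) / Rescue.gap D S A hA a ^ 2)
            ≤ alg.expectedCandQueries D S A := by
  classical
  refine ⟨3 / 256, by norm_num, ?_⟩
  intro η δ hη _ hδ0 hδ m S A hA hSA cstar hcs γ hγ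
  set g : Fin m → ℝ := Function.update γ cstar 0 with hg
  have hgstar : g cstar = 0 := by simp [hg]
  have hg_ne : ∀ a, a ≠ cstar → g a = γ a := fun a ha => by simp [hg, ha]
  have hg0 : ∀ c ∈ A, 0 ≤ g c := by
    intro c hc
    by_cases h : c = cstar
    · rw [h, hgstar]
    · rw [hg_ne c h]; exact (hγ c hc h).1.le
  have hg4 : ∀ c ∈ A, |g c| ≤ 1 / 4 := by
    intro c hc
    rw [abs_of_nonneg (hg0 c hc)]
    by_cases h : c = cstar
    · rw [h, hgstar]; norm_num
    · rw [hg_ne c h]; exact (hγ c hc h).2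
  have hS : ∀ f : Fin m → ℝ, ∀ c ∈ S, instanceRates A f c = 0 := instanceRates_committee hSA
  have hmiss : ∀ f : Fin m → ℝ, 0 < missRate (productLaw (instanceRates A f)) S := fun f => by
    rw [missRate_productLaw _ S (hS f)]; exact one_pos
  have hgap : ∀ a ∈ A, gap (productLaw (instanceRates A g)) S A hA a = g a := by
    intro a ha
    rw [gap, bestRate_instance hA hSA hg4 hcs (fun c hc => hgstar ▸ hg0 c hc), hgstar,
      rescueRate_productLaw _ S (hS g), instanceRates_of_mem ha (hg4 a ha)]
    ring
  refine ⟨productLaw (instanceRates A g), inferInstance, hmiss g, ?_, ?_, ?_⟩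
  · rw [hgap cstar hcs, hgstar]
  · intro a ha hne
    rw [hgap a ha, hg_ne a hne]
  intro R _ alg halg
  have := alg.isProbabilityMeasure_seedLaw
  have hrunprob : ∀ f : Fin m → ℝ,
      IsProbabilityMeasure (alg.runLaw (productLaw (instanceRates A f)) S) := fun f => by
    rw [runLaw_productLaw alg _ S (hS f)]; infer_instance
  have hterm : ∀ a ∈ A.filter fun a => η < gap (productLaw (instanceRates A g)) S A hA a,
      ENNReal.ofReal (3 / 256 * (Real.log (1 / δ)
          / gap (productLaw (instanceRates A g)) S A hA a ^ 2))
        ≤ ∫⁻ x, alg.expertQueries a x.1 x.2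
            ∂(alg.runLaw (productLaw (instanceRates A g)) S) := by
    intro a ha
    obtain ⟨haA, hηa⟩ := Finset.mem_filter.1 ha
    have hret := halg.returns_le (hmiss g) hηa
    rw [hgap a haA] at hηa ⊢
    have hga : 0 < g a := hη.trans hηa
    have hga4 : g a ≤ 1 / 4 := (abs_le.1 (hg4 a haA)).2
    have hane : a ≠ cstar := by
      rintro rfl
      linarith
    -- The alternative instance lifts the rate of `a` from `1/2 - g a` to `1/2 + g a`, which makes
    -- `a` the only acceptable answer.
    set g' : Fin m → ℝ := Function.update g a (-g a) with hg'
    have hg'a : g' a = -g a := by simp [hg']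
    have hg'_ne : ∀ c, c ≠ a → g' c = g c := fun c hc => by simp [hg', hc]
    have hg'4 : ∀ c ∈ A, |g' c| ≤ 1 / 4 := by
      intro c hc
      by_cases h : c = a
      · rw [h, hg'a, abs_neg]; exact hg4 a haA
      · rw [hg'_ne c h]; exact hg4 c hc
    have hmin' : ∀ c ∈ A, g' a ≤ g' c := by
      intro c hc
      by_cases h : c = a
      · rw [h]
      · rw [hg'_ne c h, hg'a]; linarith [hg0 c hc]
    have hret' := halg.le_returns (D := productLaw (instanceRates A g')) (hmiss g') (a := a) (by
      intro c hc hca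
      rw [gap, bestRate_instance hA hSA hg'4 haA hmin', rescueRate_productLaw _ S (hS g'),
        instanceRates_of_mem hc (hg'4 c hc), hg'a, hg'_ne c hca]
      linarith [hg0 c hc])
    rw [runLaw_productLaw alg _ S (hS _)] at hret hret' ⊢
    have hp := instanceRates_of_mem haA (hg4 a haA)
    have hq := instanceRates_of_mem haA (hg'4 a haA)
    rw [hg'a] at hq
    refine le_trans (ENNReal.ofReal_le_ofReal ?_)
      (alg.le_lintegral_expertQueries (θ := instanceRates A g) (θ' := instanceRates A g')
        -- `χ²` between the coins `1/2 ∓ g a` is `4 (g a)² / (1/4 - (g a)²)`, and `g a ≤ 1/4`.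
        (K := 64 / 3 * g a ^ 2) (by positivity) ?_
        (by rw [hp]; linarith) (by rw [hp]; linarith) (by rw [hq]; linarith)
        (by rw [hq]; linarith) ?_ hδ0 hδ hret hret')
    · rw [le_div_iff₀ (by positivity)]
      have hlog := quarter_log_le_log_odds hδ0 hδ
      calc 3 / 256 * (Real.log (1 / δ) / g a ^ 2) * (64 / 3 * g a ^ 2)
          = Real.log (1 / δ) / 4 := by field_simp; ring
        _ ≤ _ := hlog
    · intro c hc
      simp only [instanceRates, hg'_ne c hc]
    · rw [hp, hq, div_le_iff₀ (by nlinarith)]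
      nlinarith [sq_nonneg (g a), mul_nonneg (sq_nonneg (g a))
        (show (0 : ℝ) ≤ 1 / 16 - g a ^ 2 by nlinarith)]
  have hlog0 : 0 ≤ Real.log (1 / δ) := Real.log_nonneg (by rw [le_div_iff₀ hδ0]; linarith)
  rw [Finset.mul_sum, ENNReal.ofReal_sum_of_nonneg fun a _ => by positivity]
  calc _ ≤ ∑ a ∈ A.filter fun a => η < gap (productLaw (instanceRates A g)) S A hA a,
        ∫⁻ x, alg.expertQueries a x.1 x.2
          ∂(alg.runLaw (productLaw (instanceRates A g)) S) := Finset.sum_le_sum hterm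
    _ ≤ ∑ a ∈ A, ∫⁻ x, alg.expertQueries a x.1 x.2
          ∂(alg.runLaw (productLaw (instanceRates A g)) S) :=
        Finset.sum_le_sum_of_subset (Finset.filter_subset _ _)
    _ = ∫⁻ x, ∑ a ∈ A, alg.expertQueries a x.1 x.2
          ∂(alg.runLaw (productLaw (instanceRates A g)) S) :=
        (lintegral_finsetSum A fun a _ => alg.measurable_expertQueries a).symm
    _ ≤ _ := lintegral_mono fun x => alg.sum_expertQueries_le A x.1 x.2
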